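/- Let $1\le m\le N$, $\alpha^1,\dots,\alpha^N\in\mathbb R_+^d=[0,\infty)^d$, $\mathcal A=\{\alpha^1,\dots,\alpha^N\}$, $\delta_1,\dots,\delta_N>0$ and $\alpha^0\in\operatorname{co}\mathcal A$. Let $F$ be the Fourier transform on $L_2(\mathbb R^d)$, $Fx(\xi)=\int x(t)e^{-i\langle t,\xi\rangle}\,dt$, put $(i\xi)^\beta=\prod_{r=1}^d(i\xi_r)^{\beta_r}$ (principal values), and let $D^\beta x=F^{-1}\big((i\xi)^\beta Fx(\xi)\big)$ be the Weyl derivative of order $\beta\in\mathbb R_+^d$. Let $$\mathcal W=\{x\in L_2(\mathbb R^d):(i\xi)^{\alpha^j}Fx(\xi)\in L_2(\mathbb R^d),\ j=1,\dots,N\},$$ $$W=\{x\in\mathcal W:\|D^{\alpha^j}x\|_{L_2(\mathbb R^d)}\le\delta_j,\ j=m+1,\dots,N\}.$$ A (recovery) method is any map $\Phi:(L_2(\mathbb R^d))^m\to L_2(\mathbb R^d)$; its error is $$e(\Phi)=\sup\{\|D^{\alpha^0}x-\Phi(y)\|:x\in W,\ y=(y_1,\dots,y_m)\in (L_2(\mathbb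 R^d))^m,\ \|D^{\alpha^j}x-y_j\|\le\delta_j,\ j=1,\dots,m\},$$ the error of optimal recovery is $E=\inf_\Phi e(\Phi)$, and $\Phi$ is optimal if $e(\Phi)=E$. Let $$Q=\operatorname{co}\{(\alpha^j,\ln 1/\delta_j):j=1,\dots,N\}\subset\mathbb R^{d+1},\qquad S(\beta)=\max\{z:(\beta,z)\in Q\}$$ ($S(\beta)=-\infty$ if there is no such $z$). Then $D^{\alpha^0}x\in L_2(\mathbb R^d)$ is defined for every $x\in\mathcal W$, and $$E=e^{-S(\alpha^0)}.$$ There is a support hyperplane $z=\langle\beta,\widehat\eta\rangle+\widehat a$ to the graph of $S$ at $\alpha^0$ (that is, $S(\beta)\le\langle\beta,\widehat\eta\rangle+\widehat a$ for all $\beta$, with equality at $\alpha^0$), and for each such hyperplane there are a set $J=\{j_1,\dots,j_l\}\subset\{1,\dots,N\}$ of $l\le d+1$ indices and weights $\theta_j$, $j\in J$, such that $$\ln 1/\delta_j=\langle\alpha^j,\widehat\eta\rangle+\widehat a\ \text{ and }\ \theta_j>0\ \ (j\in J),\qquad \sum_{j\in J}\theta_j=1,\qquad \sum_{j\in J}\theta_j\alpha^j=\alpha^0;\tag{$*$}$$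 they can be chosen with $\alpha^j$, $j\in J$, affinely independent. Let now any such hyperplane and any $J$ with $|J|\le d+1$ and $\theta$ satisfying $(*)$ be given, and put $M=J\cap\{1,\dots,m\}$. 1. If $M\ne\emptyset$, then there are measurable functions $a_j:\mathbb R^d\to\mathbb C$, $j\in J$, such that for almost all $\xi\in\mathbb R^d$ $$\sum_{j\in J}(i\xi)^{\alpha^j}a_j(\xi)=(i\xi)^{\alpha^0},\qquad \sum_{j\in J}\frac{\delta_j^2|a_j(\xi)|^2}{\theta_j}\le e^{-2S(\alpha^0)},$$ and for all such functions the method $\Phi(y)=F^{-1}\big(\sum_{j\in M}a_jFy_j\big)$ is well defined (the sum is in $L_2(\mathbb R^d)$ for all $y\in (L_2(\mathbb R^d))^m$) and optimal. 2. If $M=\emptyset$, then the method $\Phi(y)=0$ is optimal. 3. For all $x\in\mathcal W$ $$\|D^{\alpha^0}x\|_{L_2(\mathbb R^d)}\le\prod_{j\in J}\|D^{\alpha^j}x\|_{L_2(\mathbb R^d)}^{\theta_j},$$ and this inequality is exact: the constant $1$ on its right-hand side cannot be replaced by a smaller one, and, if the $\alpha^j$, $j\in J$, are affinely independent, there is no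 $x_0\in\mathcal W$ with $$\sup\{\|D^{\alpha^0}x\|:x\in\mathcal W,\ \|D^{\alpha^j}x\|\le\|D^{\alpha^j}x_0\|,\ j\in J\}<\prod_{j\in J}\|D^{\alpha^j}x_0\|^{\theta_j}.$$ -/

import Mathlib

open MeasureTheory Set FourierTransform
open scoped ENNReal

noncomputable section

namespace OptimalRecovery

/-! ### Optimal recovery and exact inequalities in general -/

/-- The error `e(Λ₀, W, δ, Φ)` of the recovery method `Φ` on the class `W`: the supremum of
`‖Λ₀ x - Φ y‖` over all `x ∈ W` and all data `y` with `‖Λ_j x - y_j‖ ≤ δ_j` for every `j`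
(an extended nonnegative number). -/
def recoveryError {X Y ι : Type*} [NormedAddCommGroup Y] (Λ₀ : X → Y) (Λ : ι → X → Y)
    (W : Set X) (δ : ι → ℝ) (Φ : (ι → Y) → Y) : ℝ≥0∞ :=
  ⨆ (x : X) (_ : x ∈ W) (y : ι → Y) (_ : ∀ j, ‖Λ j x - y j‖ ≤ δ j), ‖Λ₀ x - Φ y‖ₑ

/-- The error of optimal recovery `E(Λ₀, W, δ)`: the infimum of the errors of all methods. -/
def optimalError {X Y ι : Type*} [NormedAddCommGroup Y] (Λ₀ : X → Y) (Λ : ι → X → Y)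
    (W : Set X) (δ : ι → ℝ) : ℝ≥0∞ :=
  ⨅ Φ : (ι → Y) → Y, recoveryError Λ₀ Λ W δ Φ

/-- `Φ` is an optimal recovery method. -/
def IsOptimalMethod {X Y ι : Type*} [NormedAddCommGroup Y] (Λ₀ : X → Y) (Λ : ι → X → Y)
    (W : Set X) (δ : ι → ℝ) (Φ : (ι → Y) → Y) : Prop :=
  recoveryError Λ₀ Λ W δ Φ = optimalError Λ₀ Λ W δ

/-- The inequality `‖Λ₀ x‖ ≤ κ ((‖Λ_j x‖)_j)` is exact on `V`: it holds for all `x ∈ V`, and for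
no `x₀ ∈ V` is the supremum of `‖Λ₀ x‖` over the `x ∈ V` with `‖Λ_j x‖ ≤ ‖Λ_j x₀‖` for all `j`
smaller than `κ ((‖Λ_j x₀‖)_j)`. -/
def IsExactInequality {X Y ι : Type*} [NormedAddCommGroup Y] (Λ₀ : X → Y) (Λ : ι → X → Y)
    (V : Set X) (κ : (ι → ℝ) → ℝ) : Prop :=
  (∀ x ∈ V, ‖Λ₀ x‖ ≤ κ (fun j => ‖Λ j x‖)) ∧
    ¬ ∃ x₀ ∈ V, (⨆ (x : X) (_ : x ∈ V) (_ : ∀ j, ‖Λ j x‖ ≤ ‖Λ j x₀‖), ‖Λ₀ x‖ₑ) <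
      ENNReal.ofReal (κ (fun j => ‖Λ j x₀‖))

/-! ### The Fourier transform on `L₂(ℝᵈ)`, normalised as `Fx(ξ) = ∫ x(t) exp(-i⟨t, ξ⟩) dt` -/

/-- The Hilbert space `L₂(ℝᵈ)` of complex-valued functions. -/
abbrev L2 (d : ℕ) : Type :=
  Lp (α := EuclideanSpace ℝ (Fin d)) ℂ 2

theorem quasiMeasurePreserving_smul {d : ℕ} {c : ℝ} (hc : c ≠ 0) :
    Measure.QuasiMeasurePreserving (fun ξ : EuclideanSpace ℝ (Fin d) => c • ξ) volume volume := by
  refine ⟨by fun_prop, ?_⟩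
  rw [Measure.map_addHaar_smul volume hc]
  exact Measure.smul_absolutelyContinuous

theorem memLp_dilate {d : ℕ} {c : ℝ} (hc : c ≠ 0) (x : L2 d) :
    MemLp (fun ξ => x (c • ξ)) 2 volume := by
  have h : MemLp x 2 (Measure.map (fun ξ : EuclideanSpace ℝ (Fin d) => c • ξ) volume) := by
    rw [Measure.map_addHaar_smul volume hc]
    exact (Lp.memLp x).smul_measure ENNReal.ofReal_ne_top
  exact h.comp_of_map (by fun_prop)

/-- The dilation `ξ ↦ x (c ξ)`, `c ≠ 0`, of an element of `L₂(ℝᵈ)`. -/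
def dilate {d : ℕ} (c : ℝ) (hc : c ≠ 0) (x : L2 d) : L2 d :=
  (memLp_dilate hc x).toLp

theorem dilate_dilate {d : ℕ} {b c : ℝ} (hb : b ≠ 0) (hc : c ≠ 0) (hbc : b * c = 1) (x : L2 d) :
    dilate c hc (dilate b hb x) = x := by
  apply Lp.ext
  have h1 := (memLp_dilate hc (dilate b hb x)).coeFn_toLp
  have h2 := (quasiMeasurePreserving_smul (d := d) hc).ae_eq_comp (memLp_dilate hb x).coeFn_toLp
  refine h1.trans (h2.trans (Filter.Eventually.of_forall fun ξ => ?_))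
  simp [Function.comp, smul_smul, hbc]

theorem two_pi_ne_zero : (2 * Real.pi : ℝ) ≠ 0 := by positivity

/-- The Fourier transform `Fx(ξ) = ∫ x(t) exp(-i⟨t, ξ⟩) dt` on `L₂(ℝᵈ)`; the library's `𝓕` has
the kernel `exp(-2πi⟨t, ξ⟩)`. -/
def fourierL2 {d : ℕ} (x : L2 d) : L2 d :=
  dilate (2 * Real.pi)⁻¹ (inv_ne_zero two_pi_ne_zero) (𝓕 x)

/-- The inverse Fourier transform `F⁻¹` on `L₂(ℝᵈ)`. -/
def fourierInvL2 {d : ℕ} (x : L2 d) : L2 d :=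
  𝓕⁻ (dilate (2 * Real.pi) two_pi_ne_zero x)

theorem fourierInvL2_fourierL2 {d : ℕ} (x : L2 d) : fourierInvL2 (fourierL2 x) = x := by
  unfold fourierInvL2 fourierL2
  rw [dilate_dilate _ _ (inv_mul_cancel₀ two_pi_ne_zero), fourierInv_fourier_eq]

theorem fourierL2_fourierInvL2 {d : ℕ} (x : L2 d) : fourierL2 (fourierInvL2 x) = x := by
  unfold fourierInvL2 fourierL2
  rw [fourier_fourierInv_eq, dilate_dilate _ _ (mul_inv_cancel₀ two_pi_ne_zero)]

/-! ### Weyl derivatives -/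

/-- The element of `L₂(ℝᵈ)` given by a square-integrable function (`0` if `g` is not one). -/
def toL2 {d : ℕ} (g : EuclideanSpace ℝ (Fin d) → ℂ) : L2 d :=
  open Classical in if h : MemLp g 2 volume then h.toLp else 0

/-- The function `(iξ)^β = (iξ₁)^{β₁} ⋯ (iξ_d)^{β_d}`, with principal values of the powers. -/
def weylSymbol {d : ℕ} (β : Fin d → ℝ) (ξ : EuclideanSpace ℝ (Fin d)) : ℂ :=
  ∏ i, (Complex.I * (ξ i : ℂ)) ^ (β i : ℂ)

/-- `x ∈ L₂(ℝᵈ)` has a Weyl derivative of order `β` in `L₂(ℝᵈ)`: `(iξ)^β Fx(ξ)` is in `L₂`. -/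
def HasWeylDeriv {d : ℕ} (β : Fin d → ℝ) (x : L2 d) : Prop :=
  MemLp (fun ξ => weylSymbol β ξ * fourierL2 x ξ) 2 volume

/-- The Weyl derivative `D^β x = F⁻¹((iξ)^β Fx(ξ))`, for `x` with `HasWeylDeriv β x`. -/
def weylDeriv {d : ℕ} (β : Fin d → ℝ) (x : L2 d) : L2 d :=
  fourierInvL2 (toL2 fun ξ => weylSymbol β ξ * fourierL2 x ξ)

/-- The space of all `x ∈ L₂(ℝᵈ)` that have Weyl derivatives of all orders `α^j` in `L₂(ℝᵈ)`. -/
def weylSpace {d N : ℕ} (α : Fin N → Fin d → ℝ) : Set (L2 d) :=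
  {x | ∀ j, HasWeylDeriv (α j) x}

/-- The class of all `x` in `weylSpace α` with `‖D^{α^j} x‖ ≤ δ_j` for all but the first `m`
indices `j`. -/
def weylClass {d N : ℕ} (m : ℕ) (α : Fin N → Fin d → ℝ) (δ : Fin N → ℝ) : Set (L2 d) :=
  {x | x ∈ weylSpace α ∧ ∀ j : Fin N, m ≤ (j : ℕ) → ‖weylDeriv (α j) x‖ ≤ δ j}

/-! ### The function `S` and its support hyperplanes -/

/-- The polytope `Q = co {(α^j, ln 1/δ_j)}`. -/
def liftedHull {d N : ℕ} (α : Fin N → Fin d → ℝ) (δ : Fin N → ℝ) : Set ((Fin d → ℝ) × ℝ) :=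
  convexHull ℝ (range fun j => (α j, Real.log (1 / δ j)))

/-- `S(β) = max {z : (β, z) ∈ Q}`, and `-∞` if there is no such `z`. -/
def S {d N : ℕ} (α : Fin N → Fin d → ℝ) (δ : Fin N → ℝ) (β : Fin d → ℝ) : EReal :=
  ⨆ (z : ℝ) (_ : (β, z) ∈ liftedHull α δ), (z : EReal)

/-- On `co {α^j}` the supremum in the definition of `S` is a (finite) maximum. -/
theorem exists_isGreatest_S {d N : ℕ} (α : Fin N → Fin d → ℝ) (δ : Fin N → ℝ) {β : Fin d → ℝ}
    (hβ : β ∈ convexHull ℝ (range α)) :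
    ∃ z : ℝ, IsGreatest {z : ℝ | (β, z) ∈ liftedHull α δ} z ∧ S α δ β = (z : EReal) := by
  have hK : IsCompact (liftedHull α δ) := (finite_range _).isCompact_convexHull (𝕜 := ℝ)
  have himg : LinearMap.fst ℝ (Fin d → ℝ) ℝ '' liftedHull α δ = convexHull ℝ (range α) := by
    unfold liftedHull
    rw [LinearMap.image_convexHull, ← range_comp]
    rfl
  rw [← himg] at hβ
  obtain ⟨⟨b, z⟩, hz, rfl⟩ := hβ
  have hset : {w : ℝ | (b, w) ∈ liftedHull α δ} =
      Prod.snd '' (liftedHull α δ ∩ Prod.fst ⁻¹' {b}) := by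
    ext w
    constructor
    · intro h
      exact ⟨(b, w), ⟨h, rfl⟩, rfl⟩
    · rintro ⟨⟨b', w'⟩, ⟨h, hb⟩, rfl⟩
      obtain rfl : b' = b := hb
      exact h
  have hcomp : IsCompact {w : ℝ | (b, w) ∈ liftedHull α δ} := by
    rw [hset]
    exact (hK.inter_right (isClosed_singleton.preimage continuous_fst)).image continuous_snd
  obtain ⟨w, hw⟩ := hcomp.exists_isGreatest ⟨z, hz⟩
  refine ⟨w, hw, le_antisymm ?_ ?_⟩
  · exact iSup₂_le fun v hv => by exact_mod_cast hw.2 hv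
  · exact le_iSup₂_of_le w hw.1 le_rfl

/-- `z = ⟨β, η⟩ + a` is a support hyperplane to the graph of `S` at `α0`. -/
def IsSupportHyperplane {d N : ℕ} (α : Fin N → Fin d → ℝ) (δ : Fin N → ℝ) (α0 : Fin d → ℝ)
    (η : Fin d → ℝ) (a : ℝ) : Prop :=
  (∀ β : Fin d → ℝ, S α δ β ≤ ((β ⬝ᵥ η + a : ℝ) : EReal)) ∧
    S α δ α0 = ((α0 ⬝ᵥ η + a : ℝ) : EReal)

/-- At most `d + 1` points `(α^j, ln 1/δ_j)`, `j ∈ J`, of the hyperplane `z = ⟨β, η⟩ + a`, and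
weights `θ_j > 0` for which `α0` is the convex combination of the `α^j`, `j ∈ J`. -/
structure IsRepresentation {d N : ℕ} (α : Fin N → Fin d → ℝ) (δ : Fin N → ℝ) (α0 : Fin d → ℝ)
    (η : Fin d → ℝ) (a : ℝ) (J : Finset (Fin N)) (θ : Fin N → ℝ) : Prop where
  card_le : J.card ≤ d + 1
  mem_hyperplane : ∀ j ∈ J, Real.log (1 / δ j) = α j ⬝ᵥ η + a
  pos : ∀ j ∈ J, 0 < θ j
  sum_eq_one : ∑ j ∈ J, θ j = 1
  sum_smul_eq : ∑ j ∈ J, θ j • α j = α0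

/-- The conditions on the functions `a_j`, `j ∈ J`, that define a method: they are measurable and,
for almost all `ξ`, `∑ (iξ)^{α^j} a_j(ξ) = (iξ)^{α0}` and
`∑ δ_j² |a_j(ξ)|² / θ_j ≤ exp (-2 S(α0))`. -/
structure IsAdmissible {d N : ℕ} (α : Fin N → Fin d → ℝ) (δ : Fin N → ℝ) (α0 : Fin d → ℝ)
    (J : Finset (Fin N)) (θ : Fin N → ℝ) (a : Fin N → EuclideanSpace ℝ (Fin d) → ℂ) : Prop where
  aemeasurable : ∀ j ∈ J, AEMeasurable (a j) volume
  sum_symbol : ∀ᵐ ξ, ∑ j ∈ J, weylSymbol (α j) ξ * a j ξ = weylSymbol α0 ξ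
  sum_sq_le : ∀ᵐ ξ, ∑ j ∈ J, δ j ^ 2 * ‖a j ξ‖ ^ 2 / θ j ≤ Real.exp (-2 * (S α δ α0).toReal)

/-- The set `M` of those of the first `m` indices that belong to `J`. -/
def informed {m N : ℕ} (hmN : m ≤ N) (J : Finset (Fin N)) : Finset (Fin m) :=
  Finset.univ.filter fun i => Fin.castLE hmN i ∈ J

/-- The function `∑_{j ∈ M} a_j(ξ) Fy_j(ξ)`. -/
def filteredData {d m N : ℕ} (hmN : m ≤ N) (J : Finset (Fin N))
    (a : Fin N → EuclideanSpace ℝ (Fin d) → ℂ) (y : Fin m → L2 d)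
    (ξ : EuclideanSpace ℝ (Fin d)) : ℂ :=
  ∑ i ∈ informed hmN J, a (Fin.castLE hmN i) ξ * fourierL2 (y i) ξ

/-- The method `Φ(y) = F⁻¹(∑_{j ∈ M} a_j Fy_j)`. -/
def filterMethod {d m N : ℕ} (hmN : m ≤ N) (J : Finset (Fin N))
    (a : Fin N → EuclideanSpace ℝ (Fin d) → ℂ) (y : Fin m → L2 d) : L2 d :=
  fourierInvL2 (toL2 (filteredData hmN J a y))

end OptimalRecovery

end

open OptimalRecovery

/-! On the Fourier side `D^β` is multiplication by `(iξ)^β`, and for real `β` the modulus `|(iξ)^β|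
= ∏ |ξ_i|^{β_i}` is log-linear in `β`. So a relation `∑ θ_j α^j = α⁰` makes `|(iξ)^{α⁰}|` the
weighted geometric mean of the `|(iξ)^{α^j}|`, and all estimates reduce to pointwise inequalities in
`ξ`.

Lower bound. A hyperplane `z = ⟨β, η⟩ + a` singles out the frequency `p = (e^{-η_i})`, where
`|(ip)^β| = e^{-⟨β,η⟩}` for every `β` at once. A function whose Fourier transform is a multiple of
the indicator of a small ball about `p` has `‖D^β x‖` close to `e^{-(⟨β,η⟩+a)}` for `β = α⁰` and at
most that for the `α^j` (`exists_concentrated`). If the hyperplane supports `S` at `α⁰`, these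
bounds are at most `δ_j`, while `‖D^{α⁰}x‖` is nearly `e^{-S(α⁰)}`. Both `x` and `-x` are compatible
with the data `0`, so no method does better than `e^{-S(α⁰)}` (`le_recoveryError`).

Upper bound. For data extended by `0`, the error of a filter is `∑ a_j F(D^{α^j}x - y_j)` in Fourier
variables, and a weighted Cauchy–Schwarz inequality bounds it by `e^{-S(α⁰)}`
(`norm_le_of_ae_eq_sum_mul`, `recoveryError_filterMethod_le`). Suitable `a_j` exist by AM–GM,
because the points with `j ∈ J` lie on the hyperplane (`exists_isAdmissible`).

The convex geometry comes from Farkas' lemma (the hyperplane) and Carathéodory's theorem (the set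
`J`). The multiplicative inequality is Hölder's, and its exactness is again `exists_concentrated`.
-/

namespace OptimalRecovery

section

/-! ### Finite systems of linear inequalities -/

/-- **Farkas' lemma** for finitely many vectors. -/
theorem farkas {V : Type*} [AddCommGroup V] [Module ℝ V] {n : ℕ} (v : Fin n → V) (b : V) :
    (∃ c : Fin n → ℝ, (∀ i, 0 ≤ c i) ∧ ∑ i, c i • v i = b) ∨
      ∃ f : V →ₗ[ℝ] ℝ, (∀ i, 0 ≤ f (v i)) ∧ f b < 0 := by
  induction n generalizing b with
  | zero =>
    by_cases hb : b = 0
    · exact Or.inl ⟨fun _ => 0, fun _ => le_rfl, by simp [hb]⟩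
    · obtain ⟨f, hf⟩ : ∃ f : V →ₗ[ℝ] ℝ, f b ≠ 0 := by
        by_contra! h
        exact hb ((Module.forall_dual_apply_eq_zero_iff ℝ b).1 h)
      rcases hf.lt_or_gt with h | h
      · exact Or.inr ⟨f, fun i => i.elim0, h⟩
      · exact Or.inr ⟨-f, fun i => i.elim0, by simpa using h⟩
  | succ n ih =>
    rcases ih (fun i => v i.succ) b with ⟨c, hc, hb⟩ | ⟨f, hf, hfb⟩
    · refine Or.inl ⟨Fin.cons 0 c, fun i => ?_, ?_⟩
      · refine Fin.cases (by simp) (fun i => by simpa using hc i) i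
      · simpa [Fin.sum_univ_succ] using hb
    by_cases h0 : 0 ≤ f (v 0)
    · exact Or.inr ⟨f, Fin.cases h0 hf, hfb⟩
    push Not at h0
    -- The functional `f` fails only at `v 0`, so everything is projected onto `ker f` along `v 0`
    -- and the induction hypothesis is used again. A separating functional composed with `π`
    -- vanishes at `v 0`. A conic combination of the projections lifts, and the signs of `f` make
    -- the resulting coefficient of `v 0` nonnegative.
    let π : V →ₗ[ℝ] V := LinearMap.id - (f.smulRight ((f (v 0))⁻¹ • v 0))
    have hπ : ∀ x, π x = x - (f x * (f (v 0))⁻¹) • v 0 := fun x => by simp [π, smul_smul]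
    rcases ih (fun i => π (v i.succ)) (π b) with ⟨c, hc, hb⟩ | ⟨g, hg, hgb⟩
    · refine Or.inl ⟨Fin.cons (f b * (f (v 0))⁻¹ -
        ∑ i, c i * (f (v i.succ) * (f (v 0))⁻¹)) c, fun i => ?_, ?_⟩
      · refine Fin.cases ?_ (fun i => by simpa using hc i) i
        have h1 : 0 ≤ f b * (f (v 0))⁻¹ :=
          mul_nonneg_of_nonpos_of_nonpos hfb.le (inv_nonpos.2 h0.le)
        have h2 : ∑ i, c i * (f (v i.succ) * (f (v 0))⁻¹) ≤ 0 :=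
          Finset.sum_nonpos fun i _ => mul_nonpos_of_nonneg_of_nonpos (hc i)
            (mul_nonpos_of_nonneg_of_nonpos (hf i) (inv_nonpos.2 h0.le))
        simp only [Fin.cons_zero]
        linarith
      · simp only [hπ, smul_sub, Finset.sum_sub_distrib, smul_smul, ← Finset.sum_smul] at hb
        simp only [Fin.sum_univ_succ, Fin.cons_zero, Fin.cons_succ, sub_smul]
        rw [sub_eq_sub_iff_add_eq_add] at hb
        rw [sub_add_eq_add_sub, add_comm, hb, add_sub_cancel_right]
    · refine Or.inr ⟨g ∘ₗ π, fun i => ?_, hgb⟩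
      refine Fin.cases ?_ hg i
      simp [hπ, mul_inv_cancel₀ h0.ne]

theorem linearMap_prod_pi_apply {d : ℕ} (f : (Fin d → ℝ) × ℝ →ₗ[ℝ] ℝ) (β : Fin d → ℝ) (t : ℝ) :
    f (β, t) = β ⬝ᵥ (fun i => f (Pi.single i 1, 0)) + t * f (0, 1) := by
  have h1 : f (β, t) = (f ∘ₗ LinearMap.inl ℝ (Fin d → ℝ) ℝ) β + t * f (0, 1) := by
    rw [← smul_eq_mul, ← map_smul, LinearMap.comp_apply, ← map_add]
    simp
  rw [h1, LinearMap.pi_apply_eq_sum_univ]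
  have h2 : ∀ i : Fin d, (fun j => if i = j then (1 : ℝ) else 0) = Pi.single i 1 := fun i => by
    ext j
    simp [Pi.single_apply, eq_comm]
  simp [dotProduct, h2]

theorem sum_smul_dotProduct {d : ℕ} {ι : Type*} (s : Finset ι) (w : ι → ℝ)
    (v : ι → Fin d → ℝ) (η : Fin d → ℝ) :
    (∑ j ∈ s, w j • v j) ⬝ᵥ η = ∑ j ∈ s, w j * (v j ⬝ᵥ η) := by
  rw [sum_dotProduct]
  simp [smul_dotProduct]

/-- An affine function with prescribed values at affinely independent points. -/
theorem exists_dotProduct_add_eq {d : ℕ} {ι : Type*} [Fintype ι] {p : ι → Fin d → ℝ}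
    (hp : AffineIndependent ℝ p) (b : ι → ℝ) :
    ∃ (η : Fin d → ℝ) (a : ℝ), ∀ j, p j ⬝ᵥ η + a = b j := by
  classical
  -- Homogenisation: affine functions of `p j` are linear functionals of `(p j, 1)`, and these
  -- vectors are linearly independent.
  have hli : LinearIndependent ℝ fun j => ((p j, 1) : (Fin d → ℝ) × ℝ) := by
    rw [Fintype.linearIndependent_iff]
    intro g hg
    have h1 := congrArg Prod.fst hg
    have h2 := congrArg Prod.snd hg
    simp only [Prod.fst_sum, Prod.snd_sum, Prod.smul_mk, smul_eq_mul, mul_one, Prod.fst_zero,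
      Prod.snd_zero] at h1 h2
    exact fun i => affineIndependent_iff.1 hp Finset.univ g h2 h1 i (Finset.mem_univ i)
  obtain ⟨g, hg⟩ := LinearMap.exists_leftInverse_of_injective _
    (LinearMap.ker_eq_bot.2 hli.fintypeLinearCombination_injective)
  let f : (Fin d → ℝ) × ℝ →ₗ[ℝ] ℝ := Fintype.linearCombination ℝ b ∘ₗ g
  refine ⟨fun i => f (Pi.single i 1, 0), f (0, 1), fun j => ?_⟩
  have h := linearMap_prod_pi_apply f (p j) 1
  rw [one_mul] at h
  rw [← h]
  have h2 := LinearMap.congr_fun hg (Pi.single j 1)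
  simp only [LinearMap.comp_apply, Fintype.linearCombination_apply_single, one_smul,
    LinearMap.id_apply] at h2
  simp [f, h2]

/-! ### Representations on support hyperplanes -/

theorem mem_convexHull_range_iff {E ι : Type*} [AddCommGroup E] [Module ℝ E] [Fintype ι]
    {v : ι → E} {x : E} :
    x ∈ convexHull ℝ (range v) ↔
      ∃ w : ι → ℝ, (∀ i, 0 ≤ w i) ∧ ∑ i, w i = 1 ∧ ∑ i, w i • v i = x := by
  classical
  constructor
  · intro hx
    rw [convexHull_range_eq_exists_affineCombination] at hx
    obtain ⟨s, w, h0, h1, rfl⟩ := hx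
    refine ⟨fun i => if i ∈ s then w i else 0, fun i => ?_, ?_, ?_⟩
    · by_cases h : i ∈ s <;> simp [h, h0]
    · simpa using h1
    · rw [s.affineCombination_eq_linear_combination v w h1]
      simp [ite_smul]
  · rintro ⟨w, h0, h1, h2⟩
    exact mem_convexHull_of_exists_fintype w v h0 h1 (fun i => mem_range_self i) h2

variable {d N : ℕ} {α : Fin N → Fin d → ℝ} {δ : Fin N → ℝ} {α0 : Fin d → ℝ}

theorem mem_liftedHull_iff {β : Fin d → ℝ} {z : ℝ} :
    (β, z) ∈ liftedHull α δ ↔ ∃ w : Fin N → ℝ, (∀ j, 0 ≤ w j) ∧ ∑ j, w j = 1 ∧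
      ∑ j, w j • α j = β ∧ ∑ j, w j * Real.log (1 / δ j) = z := by
  unfold liftedHull
  rw [mem_convexHull_range_iff]
  simp [Prod.ext_iff, Prod.fst_sum, Prod.snd_sum]

theorem coe_le_S {β : Fin d → ℝ} {z : ℝ} (h : (β, z) ∈ liftedHull α δ) : (z : EReal) ≤ S α δ β :=
  le_iSup₂_of_le z h le_rfl

theorem log_le_of_S_le {η : Fin d → ℝ} {a : ℝ}
    (h : ∀ β : Fin d → ℝ, S α δ β ≤ ((β ⬝ᵥ η + a : ℝ) : EReal)) (j : Fin N) :
    Real.log (1 / δ j) ≤ α j ⬝ᵥ η + a := by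
  have hj : (α j, Real.log (1 / δ j)) ∈ liftedHull α δ :=
    subset_convexHull ℝ _ (mem_range_self j)
  exact_mod_cast (coe_le_S hj).trans (h (α j))

theorem sum_mul_affine (s : Finset (Fin N)) {w : Fin N → ℝ} (h1 : ∑ j ∈ s, w j = 1)
    (h2 : ∑ j ∈ s, w j • α j = α0) (η : Fin d → ℝ) (a : ℝ) :
    ∑ j ∈ s, w j * (α j ⬝ᵥ η + a) = α0 ⬝ᵥ η + a := by
  rw [← h2, sum_smul_dotProduct]
  simp only [mul_add, Finset.sum_add_distrib, ← Finset.sum_mul, h1, one_mul]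

/-- The hyperplane solves a finite system of linear inequalities: above every lifted point, and not
above `(α0, S(α0))`. By Farkas' lemma, failure would produce a point of the lifted hull strictly
above `(α0, S(α0))`. -/
theorem exists_isSupportHyperplane (hα0 : α0 ∈ convexHull ℝ (range α)) :
    ∃ η a, IsSupportHyperplane α δ α0 η a := by
  obtain ⟨z, hz, hS⟩ := exists_isGreatest_S α δ hα0
  let v : Fin (N + 1) → ((Fin d → ℝ) × ℝ) × ℝ :=
    Fin.cons ((-α0, -1), z) fun j => ((α j, 1), -Real.log (1 / δ j))
  -- The target `(0, 0, -1)` makes a separating functional positive on the vertical direction, so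
  -- its hyperplane is not vertical and can be solved for `z`.
  rcases farkas v ((0, 0), -1) with ⟨c, hc, hsum⟩ | ⟨f, hf, hneg⟩
  · exfalso
    rw [Fin.sum_univ_succ] at hsum
    simp only [v, Fin.cons_zero, Fin.cons_succ, Prod.ext_iff, Prod.fst_add, Prod.snd_add,
      Prod.smul_fst, Prod.smul_snd, Prod.fst_sum, Prod.snd_sum, smul_eq_mul, mul_neg, mul_one,
      smul_neg, Finset.sum_neg_distrib] at hsum
    obtain ⟨⟨h1, h2⟩, h3⟩ := hsum
    have h2' : ∑ j : Fin N, c j.succ = c 0 := by linarith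
    rcases (hc 0).eq_or_lt with h0 | h0
    · rw [← h0] at h2'
      have hz' := (Finset.sum_eq_zero_iff_of_nonneg fun j _ => hc _).1 h2'
      rw [Finset.sum_eq_zero (fun j hj => by rw [hz' j hj, zero_mul]), ← h0] at h3
      norm_num at h3
    · have hmem : (α0, (c 0)⁻¹ * ∑ j : Fin N, c j.succ * Real.log (1 / δ j)) ∈
          liftedHull α δ := by
        rw [mem_liftedHull_iff]
        refine ⟨fun j => (c 0)⁻¹ * c j.succ, fun j => mul_nonneg (inv_nonneg.2 h0.le) (hc _),
          ?_, ?_, ?_⟩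
        · rw [← Finset.mul_sum, h2', inv_mul_cancel₀ h0.ne']
        · have h1' : ∑ j : Fin N, c j.succ • α j = c 0 • α0 := by
            rw [neg_add_eq_zero] at h1
            exact h1.symm
          simp only [mul_smul, ← Finset.smul_sum]
          rw [h1', smul_smul, inv_mul_cancel₀ h0.ne', one_smul]
        · simp only [mul_assoc, ← Finset.mul_sum]
      have h4 : (c 0)⁻¹ * ∑ j : Fin N, c j.succ * Real.log (1 / δ j) ≤ z := hz.2 hmem
      rw [inv_mul_le_iff₀ h0] at h4
      linarith
  · let g : (Fin d → ℝ) × ℝ →ₗ[ℝ] ℝ := f ∘ₗ LinearMap.inl ℝ ((Fin d → ℝ) × ℝ) ℝ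
    have hfg : ∀ β t s, f ((β, t), s) = g (β, t) + s * f (0, 1) := by
      intro β t s
      rw [← smul_eq_mul, ← map_smul, LinearMap.comp_apply, ← map_add]
      simp
    have hs : 0 < f (0, 1) := by
      rw [hfg, show ((0 : Fin d → ℝ), (0 : ℝ)) = 0 from rfl, map_zero] at hneg
      linarith
    set s := f (0, 1)
    have key : ∀ β : Fin d → ℝ, β ⬝ᵥ (fun i => s⁻¹ * g (Pi.single i 1, 0)) + s⁻¹ * g (0, 1) =
        s⁻¹ * g (β, 1) := by
      intro β
      rw [linearMap_prod_pi_apply g β 1, one_mul, mul_add]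
      simp only [dotProduct, Finset.mul_sum]
      congr 1
      exact Finset.sum_congr rfl fun i _ => by ring
    have hle : ∀ β : Fin d → ℝ, S α δ β ≤ ((s⁻¹ * g (β, 1) : ℝ) : EReal) := by
      intro β
      refine iSup₂_le fun y hy => ?_
      obtain ⟨w, hw0, hw1, hw2, hw3⟩ := mem_liftedHull_iff.1 hy
      rw [EReal.coe_le_coe_iff, ← key, ← hw3, ← sum_mul_affine Finset.univ hw1 hw2]
      refine Finset.sum_le_sum fun j _ => mul_le_mul_of_nonneg_left ?_ (hw0 j)
      have := hf j.succ
      simp only [v, Fin.cons_succ, hfg] at this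
      rw [key, le_inv_mul_iff₀ hs]
      linarith
    refine ⟨_, _, fun β => (key β).symm ▸ hle β, ?_⟩
    rw [key]
    refine le_antisymm (hle α0) ?_
    rw [hS, EReal.coe_le_coe_iff, inv_mul_le_iff₀ hs]
    have := hf 0
    simp only [v, Fin.cons_zero, hfg] at this
    rw [show ((-α0, (-1 : ℝ)) : (Fin d → ℝ) × ℝ) = -(α0, 1) from rfl, map_neg] at this
    linarith

theorem exists_isRepresentation (hα0 : α0 ∈ convexHull ℝ (range α)) {η : Fin d → ℝ} {a : ℝ}
    (h : IsSupportHyperplane α δ α0 η a) :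
    ∃ J θ, IsRepresentation α δ α0 η a J θ ∧ AffineIndependent ℝ (fun j : J => α j) := by
  classical
  obtain ⟨z, hz, hS⟩ := exists_isGreatest_S α δ hα0
  obtain ⟨w, hw0, hw1, hw2, hw3⟩ := mem_liftedHull_iff.1 hz.1
  have hza : z = α0 ⬝ᵥ η + a := by exact_mod_cast hS.symm.trans h.2
  have hle := log_le_of_S_le h.1
  -- Complementary slackness: the weighted sum of the inequalities `log (1 / δ j) ≤ α j ⬝ᵥ η + a` is
  -- an equality, so every term of positive weight is tight.
  have hact : ∀ j, w j ≠ 0 → Real.log (1 / δ j) = α j ⬝ᵥ η + a := by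
    intro j hj
    have hs : ∑ j, w j * Real.log (1 / δ j) = ∑ j, w j * (α j ⬝ᵥ η + a) := by
      rw [hw3, sum_mul_affine Finset.univ hw1 hw2, hza]
    have := (Finset.sum_eq_sum_iff_of_le fun j _ =>
      mul_le_mul_of_nonneg_left (hle j) (hw0 j)).1 hs j (Finset.mem_univ j)
    exact mul_left_cancel₀ hj this
  have hmem : α0 ∈ convexHull ℝ (α '' {j | Real.log (1 / δ j) = α j ⬝ᵥ η + a}) := by
    rw [← hw2]
    have hfil : ∑ j, w j • α j = ∑ j with w j ≠ 0, w j • α j := by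
      rw [Finset.sum_filter_of_ne]
      intro j _ hj hw
      simp [hw] at hj
    rw [hfil]
    refine (convex_convexHull ℝ _).sum_mem (fun j _ => hw0 j) ?_ fun j hj => ?_
    · rw [Finset.sum_filter_ne_zero, hw1]
    · exact subset_convexHull ℝ _ (mem_image_of_mem α (hact j (Finset.mem_filter.1 hj).2))
  -- Carathéodory within the tight points. Affine independence gives both the bound `d + 1` and the
  -- injectivity of the choice `k` of indices.
  obtain ⟨ι, _, p, θ, hp, haff, hpos, hsum, hcomb⟩ := eq_pos_convex_span_of_mem_convexHull hmem
  choose k hk hkp using fun i => hp (mem_range_self i)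
  have hkinj : Function.Injective k := fun i i' hii => haff.injective (by rw [← hkp, hii, hkp])
  have hext : ∀ i, Function.extend k θ 0 (k i) = θ i := fun i => hkinj.extend_apply θ 0 i
  have hJ : ∀ j ∈ Finset.univ.image k, ∃ i, k i = j := by simp
  refine ⟨Finset.univ.image k, Function.extend k θ 0, ⟨?_, ?_, ?_, ?_, ?_⟩, ?_⟩
  · rw [Finset.card_image_of_injective _ hkinj]
    have := haff.card_le_finrank_succ
    rw [Finset.card_univ]
    refine this.trans ?_
    have h3 := Submodule.finrank_le (vectorSpan ℝ (range p))
    rw [Module.finrank_fin_fun] at h3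
    omega
  · intro j hj
    obtain ⟨i, rfl⟩ := hJ j hj
    exact hk i
  · intro j hj
    obtain ⟨i, rfl⟩ := hJ j hj
    rw [hext]
    exact hpos i
  · rw [Finset.sum_image fun i _ i' _ hii => hkinj hii]
    simpa only [hext] using hsum
  · rw [Finset.sum_image fun i _ i' _ hii => hkinj hii]
    simpa only [hext, hkp] using hcomb
  · choose r hr using fun j : (Finset.univ.image k : Finset (Fin N)) => hJ j j.2
    have hrinj : Function.Injective r := fun j j' hjj => Subtype.ext (by rw [← hr, hjj, hr])
    have := haff.comp_embedding ⟨r, hrinj⟩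
    have heq : (fun j : (Finset.univ.image k : Finset (Fin N)) => α j) = p ∘ r := by
      funext j
      rw [Function.comp_apply, ← hkp, hr]
    rw [heq]
    exact this


end

section

/-! ### The Fourier transform multiplies the norm by a constant -/

theorem exists_norm_dilate (d : ℕ) {c : ℝ} (hc : c ≠ 0) :
    ∃ k : ℝ, 0 < k ∧ ∀ x : L2 d, ‖dilate c hc x‖ = k * ‖x‖ := by
  have hpos : 0 < |(c ^ d)⁻¹| := abs_pos.2 (inv_ne_zero (pow_ne_zero d hc))
  refine ⟨(|(c ^ d)⁻¹|) ^ (1 / 2 : ℝ), by positivity, fun x => ?_⟩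
  have hmap : Measure.map (fun ξ : EuclideanSpace ℝ (Fin d) => c • ξ) volume =
      ENNReal.ofReal |(c ^ d)⁻¹| • volume := by
    rw [Measure.map_addHaar_smul volume hc, finrank_euclideanSpace_fin]
  have hx : AEStronglyMeasurable x
      (Measure.map (fun ξ : EuclideanSpace ℝ (Fin d) => c • ξ) volume) := by
    rw [hmap]
    exact (Lp.memLp x).1.smul_measure _
  have h := eLpNorm_map_measure (p := 2) hx (by fun_prop)
  rw [hmap, eLpNorm_smul_measure_of_ne_top (by norm_num)] at h
  unfold dilate
  rw [Lp.norm_toLp, Lp.norm_def]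
  change (eLpNorm (x ∘ fun ξ : EuclideanSpace ℝ (Fin d) => c • ξ) 2 volume).toReal = _
  rw [← h, smul_eq_mul, ENNReal.toReal_mul, ← ENNReal.toReal_rpow,
    ENNReal.toReal_ofReal hpos.le]
  norm_num

/-- Plancherel up to a factor. Its value is never needed, since it cancels from every norm estimate
below. -/
theorem exists_norm_fourierL2 (d : ℕ) :
    ∃ k : ℝ, 0 < k ∧ ∀ x : L2 d, ‖fourierL2 x‖ = k * ‖x‖ := by
  obtain ⟨k, hk, h⟩ := exists_norm_dilate d (inv_ne_zero two_pi_ne_zero)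
  refine ⟨k, hk, fun x => ?_⟩
  unfold fourierL2
  rw [h, Lp.norm_fourier_eq]

theorem dilate_sub {d : ℕ} {c : ℝ} (hc : c ≠ 0) (x y : L2 d) :
    dilate c hc (x - y) = dilate c hc x - dilate c hc y := by
  apply Lp.ext
  have h := (quasiMeasurePreserving_smul (d := d) hc).ae_eq_comp (Lp.coeFn_sub x y)
  filter_upwards [h, (memLp_dilate hc (x - y)).coeFn_toLp, (memLp_dilate hc x).coeFn_toLp,
    (memLp_dilate hc y).coeFn_toLp, Lp.coeFn_sub (dilate c hc x) (dilate c hc y)]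
    with ξ h1 h2 h3 h4 h5
  rw [h5, Pi.sub_apply]
  unfold dilate
  rw [h2, h3, h4]
  exact h1

theorem fourierL2_sub {d : ℕ} (x y : L2 d) : fourierL2 (x - y) = fourierL2 x - fourierL2 y := by
  unfold fourierL2
  rw [← dilate_sub]
  exact congrArg _ ((Lp.fourierTransformₗᵢ _ _).map_sub x y)

theorem fourierL2_zero {d : ℕ} : fourierL2 (0 : L2 d) = 0 := by
  simpa using fourierL2_sub (0 : L2 d) 0

theorem fourierL2_neg {d : ℕ} (x : L2 d) : fourierL2 (-x) = -fourierL2 x := by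
  rw [← zero_sub, fourierL2_sub, fourierL2_zero, zero_sub]

theorem fourierL2_injective {d : ℕ} : Function.Injective (fourierL2 (d := d)) :=
  Function.LeftInverse.injective fourierInvL2_fourierL2

/-! ### Weyl derivatives on the Fourier side -/

variable {d : ℕ}

theorem coeFn_toL2 {g : EuclideanSpace ℝ (Fin d) → ℂ} (hg : MemLp g 2 volume) :
    toL2 g =ᵐ[volume] g := by
  unfold toL2
  rw [dif_pos hg]
  exact hg.coeFn_toLp

theorem fourierL2_weylDeriv {β : Fin d → ℝ} {x : L2 d} (hx : HasWeylDeriv β x) :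
    fourierL2 (weylDeriv β x) =ᵐ[volume] fun ξ => weylSymbol β ξ * fourierL2 x ξ := by
  unfold weylDeriv
  rw [fourierL2_fourierInvL2]
  exact coeFn_toL2 hx

theorem measurable_weylSymbol (β : Fin d → ℝ) : Measurable (weylSymbol β) := by
  unfold weylSymbol
  refine Finset.measurable_prod _ fun i _ => Measurable.pow_const ?_ _
  fun_prop

theorem norm_weylSymbol (β : Fin d → ℝ) (ξ : EuclideanSpace ℝ (Fin d)) :
    ‖weylSymbol β ξ‖ = ∏ i, |ξ i| ^ β i := by
  unfold weylSymbol
  rw [norm_prod]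
  refine Finset.prod_congr rfl fun i _ => ?_
  rw [Complex.norm_cpow_real]
  simp

theorem continuous_norm_weylSymbol {β : Fin d → ℝ} (hβ : ∀ i, 0 ≤ β i) :
    Continuous fun ξ => ‖weylSymbol β ξ‖ := by
  simp only [norm_weylSymbol]
  refine continuous_finsetProd _ fun i _ => Continuous.rpow_const ?_ fun _ => Or.inr (hβ i)
  fun_prop

/-- One frequency serves all orders `β` simultaneously; the extremal functions are concentrated near
it. -/
theorem norm_weylSymbol_toLp_exp (β η : Fin d → ℝ) :
    ‖weylSymbol β (WithLp.toLp 2 fun i => Real.exp (-η i))‖ = Real.exp (-(β ⬝ᵥ η)) := by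
  rw [norm_weylSymbol, dotProduct, ← Finset.sum_neg_distrib, Real.exp_sum]
  refine Finset.prod_congr rfl fun i _ => ?_
  simp only [abs_of_pos (Real.exp_pos _)]
  rw [← Real.exp_mul]
  congr 1
  ring

theorem ae_ne_zero (d : ℕ) : ∀ᵐ ξ : EuclideanSpace ℝ (Fin d), ∀ i, ξ i ≠ 0 := by
  rw [ae_all_iff]
  intro i
  have h := (EuclideanSpace.volume_preserving_symm_measurableEquiv_toLp
    (Fin d)).quasiMeasurePreserving.ae (p := fun y => y i ≠ 0) (by
      exact Measure.ae_eval_ne (μ := fun _ : Fin d => (volume : Measure ℝ)) i 0)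
  exact h

theorem norm_weylSymbol_sum {ι : Type*} (s : Finset ι) (w : ι → ℝ) (β : ι → Fin d → ℝ)
    (ξ : EuclideanSpace ℝ (Fin d)) (hξ : ∀ i, ξ i ≠ 0) :
    ‖weylSymbol (∑ j ∈ s, w j • β j) ξ‖ = ∏ j ∈ s, ‖weylSymbol (β j) ξ‖ ^ w j := by
  simp only [norm_weylSymbol]
  have h : ∀ j ∈ s, (∏ i, |ξ i| ^ β j i) ^ w j = ∏ i, |ξ i| ^ (w j * β j i) := by
    intro j _
    rw [← Real.finsetProd_rpow _ _ fun i _ => by positivity]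
    refine Finset.prod_congr rfl fun i _ => ?_
    rw [← Real.rpow_mul (abs_nonneg _), mul_comm]
  rw [Finset.prod_congr rfl h, Finset.prod_comm]
  refine Finset.prod_congr rfl fun i _ => ?_
  rw [← Real.rpow_sum_of_pos (abs_pos.2 (hξ i))]
  simp

theorem weylSymbol_ne_zero (β : Fin d → ℝ) {ξ : EuclideanSpace ℝ (Fin d)} (hξ : ∀ i, ξ i ≠ 0) :
    weylSymbol β ξ ≠ 0 := by
  rw [← norm_pos_iff, norm_weylSymbol]
  exact Finset.prod_pos fun i _ => Real.rpow_pos_of_pos (abs_pos.2 (hξ i)) _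

variable {N : ℕ} {α : Fin N → Fin d → ℝ} {α0 : Fin d → ℝ}

/-- By AM–GM, `|(iξ)^{α0}|` is at most a convex combination of the `|(iξ)^{α^j}|`. -/
theorem hasWeylDeriv_of_mem_convexHull (hα0 : α0 ∈ convexHull ℝ (range α)) {x : L2 d}
    (hx : x ∈ weylSpace α) : HasWeylDeriv α0 x := by
  obtain ⟨w, hw0, hw1, rfl⟩ := mem_convexHull_range_iff.1 hα0
  have hsum : MemLp (fun ξ => ∑ j, w j * ‖weylSymbol (α j) ξ * fourierL2 x ξ‖) 2 volume :=
    memLp_finsetSum _ fun j _ => ((hx j).norm.const_mul (w j))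
  refine hsum.mono' ((measurable_weylSymbol _).aestronglyMeasurable.mul (Lp.memLp _).1) ?_
  filter_upwards [ae_ne_zero d] with ξ hξ
  simp only [norm_mul, ← mul_assoc, ← Finset.sum_mul]
  refine mul_le_mul_of_nonneg_right ?_ (norm_nonneg _)
  rw [norm_weylSymbol_sum _ _ _ _ hξ]
  exact Real.geom_mean_le_arith_mean_weighted _ _ _ (fun j _ => hw0 j) hw1
    fun j _ => norm_nonneg _

theorem neg_mem_weylSpace {x : L2 d} (hx : x ∈ weylSpace α) : -x ∈ weylSpace α := by
  intro j
  refine (hx j).neg.ae_eq ?_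
  rw [fourierL2_neg]
  filter_upwards [Lp.coeFn_neg (fourierL2 x)] with ξ h
  rw [h, Pi.neg_apply, Pi.neg_apply, mul_neg]

theorem weylDeriv_neg {β : Fin d → ℝ} {x : L2 d} (hx : HasWeylDeriv β x)
    (hx' : HasWeylDeriv β (-x)) : weylDeriv β (-x) = -weylDeriv β x := by
  apply fourierL2_injective
  rw [fourierL2_neg]
  apply Lp.ext
  filter_upwards [Lp.coeFn_neg (fourierL2 x), Lp.coeFn_neg (fourierL2 (weylDeriv β x)),
    fourierL2_weylDeriv hx, fourierL2_weylDeriv hx'] with ξ h1 h2 h3 h4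
  rw [h4, h2, Pi.neg_apply, h3, fourierL2_neg, h1]
  simp


end

section

/-! ### Norm inequalities from pointwise inequalities -/

theorem enorm_sq_eq_lintegral {d : ℕ} (f : L2 d) : ‖f‖ₑ ^ 2 = ∫⁻ ξ, ‖f ξ‖ₑ ^ 2 := by
  rw [Lp.enorm_def, eLpNorm_eq_lintegral_rpow_enorm_toReal (by norm_num) (by norm_num),
    ← ENNReal.rpow_natCast, ← ENNReal.rpow_mul]
  simp

theorem norm_sq_eq_integral {d : ℕ} (f : L2 d) : ‖f‖ ^ 2 = ∫ ξ, ‖f ξ‖ ^ 2 := by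
  have hm : AEStronglyMeasurable (fun ξ => ‖f ξ‖ ^ 2) volume := (Lp.memLp f).1.norm.pow 2
  rw [integral_eq_lintegral_of_nonneg_ae (Filter.Eventually.of_forall fun ξ => by positivity) hm]
  have h : ∀ z : ℂ, ENNReal.ofReal (‖z‖ ^ 2) = ‖z‖ₑ ^ 2 := fun z => by
    rw [ENNReal.ofReal_pow (norm_nonneg _), ofReal_norm]
  simp only [h]
  rw [← enorm_sq_eq_lintegral, ENNReal.toReal_pow, toReal_enorm]

/-- Hölder's inequality with exponents `1 / θ j`, applied to the functions `|f_j|²`. -/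
theorem norm_le_prod_rpow {d : ℕ} {ι : Type*} (J : Finset ι) {θ : ι → ℝ} (hθ : ∀ j ∈ J, 0 ≤ θ j)
    (h1 : ∑ j ∈ J, θ j = 1) {g : L2 d} {f : ι → L2 d}
    (h : ∀ᵐ ξ, ‖g ξ‖ = ∏ j ∈ J, ‖f j ξ‖ ^ θ j) : ‖g‖ ≤ ∏ j ∈ J, ‖f j‖ ^ θ j := by
  have hsq : ‖g‖ₑ ^ 2 ≤ (∏ j ∈ J, ‖f j‖ₑ ^ θ j) ^ 2 := by
    calc ‖g‖ₑ ^ 2 = ∫⁻ ξ, ∏ j ∈ J, (‖f j ξ‖ₑ ^ 2) ^ θ j := by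
          rw [enorm_sq_eq_lintegral]
          refine lintegral_congr_ae ?_
          filter_upwards [h] with ξ hξ
          rw [← ofReal_norm, hξ, ENNReal.ofReal_prod_of_nonneg fun j _ => by positivity,
            ← Finset.prod_pow]
          refine Finset.prod_congr rfl fun j hj => ?_
          rw [← ENNReal.ofReal_rpow_of_nonneg (norm_nonneg _) (hθ j hj), ofReal_norm,
            ← ENNReal.rpow_natCast, ← ENNReal.rpow_natCast, ← ENNReal.rpow_mul,
            ← ENNReal.rpow_mul, mul_comm]
      _ ≤ ∏ j ∈ J, (∫⁻ ξ, ‖f j ξ‖ₑ ^ 2) ^ θ j :=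
          ENNReal.lintegral_prod_norm_pow_le J (fun j _ => (Lp.memLp (f j)).1.enorm.pow_const 2)
            h1 hθ
      _ = _ := by
          rw [← Finset.prod_pow]
          refine Finset.prod_congr rfl fun j _ => ?_
          rw [← enorm_sq_eq_lintegral, ← ENNReal.rpow_natCast, ← ENNReal.rpow_natCast,
            ← ENNReal.rpow_mul, ← ENNReal.rpow_mul, mul_comm]
  have hle := (ENNReal.pow_le_pow_left_iff two_ne_zero).1 hsq
  have hrw : ∏ j ∈ J, ‖f j‖ₑ ^ θ j = ENNReal.ofReal (∏ j ∈ J, ‖f j‖ ^ θ j) := by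
    rw [ENNReal.ofReal_prod_of_nonneg fun j _ => by positivity]
    refine Finset.prod_congr rfl fun j hj => ?_
    rw [← ENNReal.ofReal_rpow_of_nonneg (norm_nonneg _) (hθ j hj), ofReal_norm]
  rw [hrw, ← ofReal_norm] at hle
  exact (ENNReal.ofReal_le_ofReal_iff (Finset.prod_nonneg fun j _ => by positivity)).1 hle

/-- Pointwise Cauchy–Schwarz with weights, `|∑ c_j f_j|² ≤ (∑ δ_j²|c_j|²/θ_j) (∑ θ_j|f_j|²/δ_j²)`.
The first factor is at most `R²`; the second integrates to at most `k² ∑ θ_j = k²`. -/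
theorem norm_le_of_ae_eq_sum_mul {d : ℕ} {ι : Type*} (J : Finset ι) {θ δ : ι → ℝ}
    (hθ : ∀ j ∈ J, 0 < θ j) (h1 : ∑ j ∈ J, θ j = 1) (hδ : ∀ j ∈ J, 0 < δ j) {R k : ℝ}
    (hR : 0 ≤ R) (hk : 0 ≤ k) {c : ι → EuclideanSpace ℝ (Fin d) → ℂ}
    (hc : ∀ᵐ ξ, ∑ j ∈ J, δ j ^ 2 * ‖c j ξ‖ ^ 2 / θ j ≤ R ^ 2) {g : L2 d} {f : ι → L2 d}
    (hg : ∀ᵐ ξ, g ξ = ∑ j ∈ J, c j ξ * f j ξ) (hf : ∀ j ∈ J, ‖f j‖ ≤ k * δ j) :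
    ‖g‖ ≤ k * R := by
  have hint : ∀ f : L2 d, Integrable fun ξ => ‖f ξ‖ ^ 2 := fun f =>
    (memLp_two_iff_integrable_sq_norm (Lp.memLp f).1).1 (Lp.memLp f)
  have hpt : ∀ᵐ ξ, ‖g ξ‖ ^ 2 ≤ R ^ 2 * ∑ j ∈ J, θ j / δ j ^ 2 * ‖f j ξ‖ ^ 2 := by
    filter_upwards [hc, hg] with ξ h2 h3
    have hle : ‖g ξ‖ ≤ ∑ j ∈ J, ‖c j ξ‖ * ‖f j ξ‖ := by
      rw [h3]
      exact (norm_sum_le _ _).trans_eq (by simp only [norm_mul])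
    refine (pow_le_pow_left₀ (norm_nonneg _) hle 2).trans ?_
    refine (Finset.sum_sq_le_sum_mul_sum_of_sq_le_mul J
      (f := fun j => δ j ^ 2 * ‖c j ξ‖ ^ 2 / θ j) (g := fun j => θ j / δ j ^ 2 * ‖f j ξ‖ ^ 2)
      (fun j hj => ?_) (fun j hj => ?_) fun j hj => ?_).trans ?_
    · have := hθ j hj
      positivity
    · have := hθ j hj
      positivity
    · have := (hθ j hj).ne'
      have := (hδ j hj).ne'
      refine le_of_eq ?_
      field_simp
    · refine mul_le_mul_of_nonneg_right h2 (Finset.sum_nonneg fun j hj => ?_)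
      have := hθ j hj
      positivity
  have hsq : ‖g‖ ^ 2 ≤ (k * R) ^ 2 := by
    rw [norm_sq_eq_integral]
    refine (integral_mono_ae (hint g)
      ((integrable_finsetSum J fun j _ => (hint (f j)).const_mul _).const_mul _) hpt).trans ?_
    rw [integral_const_mul, integral_finsetSum J fun j _ => (hint (f j)).const_mul _]
    simp only [integral_const_mul, ← norm_sq_eq_integral]
    have hsum : ∑ j ∈ J, θ j / δ j ^ 2 * ‖f j‖ ^ 2 ≤ ∑ j ∈ J, θ j * k ^ 2 := by
      refine Finset.sum_le_sum fun j hj => ?_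
      have h4 := hθ j hj
      have h5 := hδ j hj
      calc θ j / δ j ^ 2 * ‖f j‖ ^ 2 ≤ θ j / δ j ^ 2 * (k * δ j) ^ 2 := by
            gcongr
            exact hf j hj
        _ = _ := by field_simp
    rw [← Finset.sum_mul, h1, one_mul] at hsum
    calc R ^ 2 * _ ≤ R ^ 2 * k ^ 2 := by gcongr
      _ = _ := by ring
  exact le_of_sq_le_sq hsq (by positivity)

/-! ### Extremal functions -/

variable {d N : ℕ} {α : Fin N → Fin d → ℝ} {δ : Fin N → ℝ} {α0 : Fin d → ℝ}

theorem nonneg_of_mem_convexHull (hα : ∀ j i, 0 ≤ α j i) (hα0 : α0 ∈ convexHull ℝ (range α))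
    (i : Fin d) : 0 ≤ α0 i := by
  obtain ⟨w, hw0, -, rfl⟩ := mem_convexHull_range_iff.1 hα0
  rw [Finset.sum_apply]
  exact Finset.sum_nonneg fun j _ => mul_nonneg (hw0 j) (hα j i)

/-- Near `p = (e^{-η_i})` the symbols are almost constant in modulus, by continuity. One factor `s`
scales the function down so that the upper bounds hold exactly; the other is the loss in
`|(iξ)^{α0}|` on the ball. Any `η` and `a` are allowed, not only support hyperplanes. -/
theorem exists_concentrated (hα : ∀ j i, 0 ≤ α j i) (hα0 : α0 ∈ convexHull ℝ (range α))
    (η : Fin d → ℝ) (a : ℝ) {s : ℝ} (hs0 : 0 < s) (hs1 : s < 1) :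
    ∃ x ∈ weylSpace α, (∀ j, ‖weylDeriv (α j) x‖ ≤ Real.exp (-(α j ⬝ᵥ η + a))) ∧
      s ^ 2 * Real.exp (-(α0 ⬝ᵥ η + a)) ≤ ‖weylDeriv α0 x‖ := by
  obtain ⟨k, hk, hnorm⟩ := exists_norm_fourierL2 d
  set p : EuclideanSpace ℝ (Fin d) := WithLp.toLp 2 fun i => Real.exp (-η i)
  have hU : ∀ᶠ ξ in nhds p, (∀ j, s * ‖weylSymbol (α j) ξ‖ < Real.exp (-(α j ⬝ᵥ η))) ∧
      s * Real.exp (-(α0 ⬝ᵥ η)) < ‖weylSymbol α0 ξ‖ := by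
    refine Filter.Eventually.and (Filter.eventually_all.2 fun j => ?_) ?_
    · refine (continuous_const.mul (continuous_norm_weylSymbol (hα j))).continuousAt.eventually_lt
        continuousAt_const ?_
      change s * ‖weylSymbol (α j) p‖ < _
      rw [norm_weylSymbol_toLp_exp]
      exact mul_lt_of_lt_one_left (Real.exp_pos _) hs1
    · refine continuousAt_const.eventually_lt
        (continuous_norm_weylSymbol (nonneg_of_mem_convexHull hα hα0)).continuousAt ?_
      rw [norm_weylSymbol_toLp_exp]
      exact mul_lt_of_lt_one_left (Real.exp_pos _) hs1
  obtain ⟨r, hr, hball⟩ := Metric.eventually_nhds_iff_ball.1 hU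
  have hvol : 0 < volume.real (Metric.ball p r) :=
    ENNReal.toReal_pos (Metric.measure_ball_pos volume p hr).ne' measure_ball_lt_top.ne
  -- The height of the indicator is chosen to give `‖g‖ = k s e^{-a}`; `k` is the Plancherel factor.
  set A : ℝ := k * s * Real.exp (-a) / volume.real (Metric.ball p r) ^ (1 / 2 : ℝ)
  have hA : 0 < A := by positivity
  set g : L2 d := indicatorConstLp 2 measurableSet_ball
    (measure_ball_lt_top (μ := volume) (x := p) (r := r)).ne (A : ℂ) with hgdef
  have hg : ‖g‖ = k * s * Real.exp (-a) := by
    rw [hgdef, norm_indicatorConstLp (by norm_num) (by norm_num), Complex.norm_real,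
      Real.norm_of_nonneg hA.le]
    exact div_mul_cancel₀ _ (by positivity)
  have hgsupp : ∀ᵐ ξ, ξ ∉ Metric.ball p r → g ξ = 0 := indicatorConstLp_coeFn_notMem
  set x : L2 d := fourierInvL2 g
  have hxg : fourierL2 x = g := fourierL2_fourierInvL2 g
  have hle : ∀ j, ∀ᵐ ξ, ‖weylSymbol (α j) ξ * g ξ‖ ≤
      Real.exp (-(α j ⬝ᵥ η)) / s * ‖g ξ‖ := by
    intro j
    filter_upwards [hgsupp] with ξ hξ
    by_cases hm : ξ ∈ Metric.ball p r
    · rw [norm_mul]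
      gcongr
      rw [le_div_iff₀' hs0]
      exact ((hball ξ hm).1 j).le
    · simp [hξ hm]
  have hxmem : x ∈ weylSpace α := by
    intro j
    unfold HasWeylDeriv
    rw [hxg]
    exact (Lp.memLp g).of_le_mul
      ((measurable_weylSymbol _).aestronglyMeasurable.mul (Lp.memLp g).1) (hle j)
  refine ⟨x, hxmem, fun j => ?_, ?_⟩
  · have h : ‖fourierL2 (weylDeriv (α j) x)‖ ≤ Real.exp (-(α j ⬝ᵥ η)) / s * ‖g‖ := by
      apply Lp.norm_le_mul_norm_of_ae_le_mul
      filter_upwards [fourierL2_weylDeriv (hxmem j), hle j] with ξ h1 h2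
      rwa [h1, hxg]
    rw [hnorm, hg] at h
    rw [neg_add, Real.exp_add]
    refine le_of_mul_le_mul_left (h.trans_eq ?_) hk
    field_simp
  · have hx0 := hasWeylDeriv_of_mem_convexHull hα0 hxmem
    have h : ‖g‖ ≤ (s * Real.exp (-(α0 ⬝ᵥ η)))⁻¹ * ‖fourierL2 (weylDeriv α0 x)‖ := by
      apply Lp.norm_le_mul_norm_of_ae_le_mul
      filter_upwards [fourierL2_weylDeriv hx0, hgsupp] with ξ h1 h2
      rw [h1, hxg, norm_mul, ← mul_assoc]
      by_cases hm : ξ ∈ Metric.ball p r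
      · refine le_mul_of_one_le_left (norm_nonneg _) ?_
        rw [one_le_inv_mul₀ (by positivity)]
        exact (hball ξ hm).2.le
      · simp [h2 hm]
    rw [hnorm, hg, le_inv_mul_iff₀ (by positivity)] at h
    rw [neg_add, Real.exp_add]
    refine le_of_mul_le_mul_left (Eq.trans_le ?_ h) hk
    ring

/-! ### Consequences of a representation -/

theorem S_toReal {η : Fin d → ℝ} {a : ℝ} (h : IsSupportHyperplane α δ α0 η a) :
    (S α δ α0).toReal = α0 ⬝ᵥ η + a := by
  rw [h.2, EReal.toReal_coe]

/-- Since the lifted points with `j ∈ J` lie on the hyperplane, the weighted geometric mean of the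
`1 / δ j` is `exp (α0 ⬝ᵥ η + a)`. -/
theorem norm_weylSymbol_div_eq_prod {η : Fin d → ℝ} {a : ℝ} {J : Finset (Fin N)} {θ : Fin N → ℝ}
    (hδ : ∀ j, 0 < δ j) (hrep : IsRepresentation α δ α0 η a J θ)
    {ξ : EuclideanSpace ℝ (Fin d)} (hξ : ∀ i, ξ i ≠ 0) :
    ‖weylSymbol α0 ξ‖ * Real.exp (α0 ⬝ᵥ η + a) = ∏ j ∈ J, (‖weylSymbol (α j) ξ‖ / δ j) ^ θ j := by
  have h : ∀ j ∈ J, (‖weylSymbol (α j) ξ‖ / δ j) ^ θ j =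
      ‖weylSymbol (α j) ξ‖ ^ θ j * Real.exp (θ j * (α j ⬝ᵥ η + a)) := by
    intro j hj
    rw [← hrep.mem_hyperplane j hj, mul_comm (θ j), Real.exp_mul,
      Real.exp_log (one_div_pos.2 (hδ j)), ← Real.mul_rpow (norm_nonneg _)
      (one_div_pos.2 (hδ j)).le, mul_one_div]
  rw [Finset.prod_congr rfl h, Finset.prod_mul_distrib, ← Real.exp_sum,
    sum_mul_affine J hrep.sum_eq_one hrep.sum_smul_eq, ← norm_weylSymbol_sum J θ α ξ hξ,
    hrep.sum_smul_eq]

theorem exists_isAdmissible {η : Fin d → ℝ} {a : ℝ} {J : Finset (Fin N)} {θ : Fin N → ℝ}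
    (hδ : ∀ j, 0 < δ j) (hsup : IsSupportHyperplane α δ α0 η a)
    (hrep : IsRepresentation α δ α0 η a J θ) : ∃ b, IsAdmissible α δ α0 J θ b := by
  have hJ : J.Nonempty := by
    rw [Finset.nonempty_iff_ne_empty]
    rintro rfl
    simpa using hrep.sum_eq_one
  let q : EuclideanSpace ℝ (Fin d) → ℝ := fun ξ =>
    ∑ j ∈ J, θ j / δ j ^ 2 * ‖weylSymbol (α j) ξ‖ ^ 2
  have hq : ∀ ξ : EuclideanSpace ℝ (Fin d), (∀ i, ξ i ≠ 0) → 0 < q ξ := fun ξ hξ =>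
    Finset.sum_pos (fun j hj => mul_pos (div_pos (hrep.pos j hj) (pow_pos (hδ j) 2))
      (pow_pos (norm_pos_iff.2 (weylSymbol_ne_zero _ hξ)) 2)) hJ
  have hqm : Measurable q := Finset.measurable_sum _ fun j _ =>
    ((measurable_weylSymbol (α j)).norm.pow_const 2).const_mul _
  -- The equality case of Cauchy–Schwarz: these coefficients minimise `∑ δ_j²|a_j|²/θ_j` under the
  -- linear constraint. The minimum is `|(iξ)^{α0}|² / q`, and weighted AM–GM bounds it by
  -- `e^{-2S(α0)}`.
  refine ⟨fun j ξ => ((θ j / δ j ^ 2 / q ξ : ℝ) : ℂ) *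
    ((starRingEnd ℂ) (weylSymbol (α j) ξ) * weylSymbol α0 ξ), ⟨fun j _ => ?_, ?_, ?_⟩⟩
  · refine Measurable.aemeasurable ?_
    refine (Complex.measurable_ofReal.comp (measurable_const.div hqm)).mul
      (Measurable.mul ?_ (measurable_weylSymbol _))
    exact Complex.continuous_conj.measurable.comp (measurable_weylSymbol _)
  · filter_upwards [ae_ne_zero d] with ξ hξ
    have h : ∀ j ∈ J, weylSymbol (α j) ξ * (((θ j / δ j ^ 2 / q ξ : ℝ) : ℂ) *
        ((starRingEnd ℂ) (weylSymbol (α j) ξ) * weylSymbol α0 ξ)) =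
        ((θ j / δ j ^ 2 * ‖weylSymbol (α j) ξ‖ ^ 2 : ℝ) : ℂ) *
          ((q ξ : ℂ)⁻¹ * weylSymbol α0 ξ) := by
      intro j _
      have := Complex.mul_conj' (weylSymbol (α j) ξ)
      push_cast
      rw [← this]
      ring
    rw [Finset.sum_congr rfl h, ← Finset.sum_mul, ← Complex.ofReal_sum, ← mul_assoc]
    change ((q ξ : ℝ) : ℂ) * (q ξ : ℂ)⁻¹ * _ = _
    rw [mul_inv_cancel₀ (by exact_mod_cast (hq ξ hξ).ne'), one_mul]
  · filter_upwards [ae_ne_zero d] with ξ hξ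
    have hqξ := hq ξ hξ
    have h : ∀ j ∈ J, δ j ^ 2 * ‖((θ j / δ j ^ 2 / q ξ : ℝ) : ℂ) *
        ((starRingEnd ℂ) (weylSymbol (α j) ξ) * weylSymbol α0 ξ)‖ ^ 2 / θ j =
        (θ j / δ j ^ 2 * ‖weylSymbol (α j) ξ‖ ^ 2) * (‖weylSymbol α0 ξ‖ ^ 2 / q ξ ^ 2) := by
      intro j hj
      have h1 := hrep.pos j hj
      have h2 := hδ j
      rw [norm_mul, norm_mul, Complex.norm_real, RCLike.norm_conj,
        Real.norm_of_nonneg (by positivity)]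
      field_simp
    rw [Finset.sum_congr rfl h, ← Finset.sum_mul, S_toReal hsup]
    change q ξ * _ ≤ _
    have hgm : (‖weylSymbol α0 ξ‖ * Real.exp (α0 ⬝ᵥ η + a)) ^ 2 ≤ q ξ := by
      rw [norm_weylSymbol_div_eq_prod hδ hrep hξ, ← Finset.prod_pow]
      have hpow : ∀ j ∈ J, ((‖weylSymbol (α j) ξ‖ / δ j) ^ θ j) ^ 2 =
          ((‖weylSymbol (α j) ξ‖ / δ j) ^ 2) ^ θ j := by
        intro j _
        have h2 := hδ j
        rw [Real.rpow_pow_comm (by positivity)]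
      rw [Finset.prod_congr rfl hpow]
      refine (Real.geom_mean_le_arith_mean_weighted J θ _ (fun j hj => (hrep.pos j hj).le)
        hrep.sum_eq_one fun j _ => by positivity).trans_eq ?_
      refine Finset.sum_congr rfl fun j _ => ?_
      ring
    rw [show -2 * (α0 ⬝ᵥ η + a) = -((α0 ⬝ᵥ η + a) + (α0 ⬝ᵥ η + a)) by ring, Real.exp_neg,
      Real.exp_add, ← sq, ← one_div, le_div_iff₀ (by positivity)]
    rw [mul_pow] at hgm
    calc q ξ * (‖weylSymbol α0 ξ‖ ^ 2 / q ξ ^ 2) * Real.exp (α0 ⬝ᵥ η + a) ^ 2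
        = ‖weylSymbol α0 ξ‖ ^ 2 * Real.exp (α0 ⬝ᵥ η + a) ^ 2 / q ξ := by field_simp
      _ ≤ 1 := (div_le_one hqξ).2 hgm


end

section

/-! ### Upper bound for the error of filtering methods -/

variable {d m N : ℕ} {α : Fin N → Fin d → ℝ} {δ : Fin N → ℝ} {α0 : Fin d → ℝ}

theorem sum_eq_sum_informed (hmN : m ≤ N) (J : Finset (Fin N)) (f : Fin N → ℂ)
    (hf : ∀ j : Fin N, m ≤ (j : ℕ) → f j = 0) :
    ∑ j ∈ J, f j = ∑ i ∈ informed hmN J, f (Fin.castLE hmN i) := by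
  classical
  rw [← Finset.sum_image (f := f) (g := Fin.castLE hmN)
    fun i _ i' _ h => Fin.castLE_injective hmN h]
  symm
  refine Finset.sum_subset (fun j hj => ?_) fun j hj hj' => hf j ?_
  · obtain ⟨i, hi, rfl⟩ := Finset.mem_image.1 hj
    exact (Finset.mem_filter.1 hi).2
  · by_contra! hlt
    refine hj' (Finset.mem_image.2 ⟨⟨j, hlt⟩, ?_, rfl⟩)
    exact Finset.mem_filter.2 ⟨Finset.mem_univ _, hj⟩

/-- The quadratic bound makes each coefficient with index in `J` essentially bounded. -/
theorem memLp_filteredData (hmN : m ≤ N) (hδ : ∀ j, 0 < δ j) {J : Finset (Fin N)}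
    {θ : Fin N → ℝ} (hθ : ∀ j ∈ J, 0 < θ j) {b : Fin N → EuclideanSpace ℝ (Fin d) → ℂ}
    (hb : IsAdmissible α δ α0 J θ b) (y : Fin m → L2 d) :
    MemLp (filteredData hmN J b y) 2 volume := by
  refine memLp_finsetSum _ fun i hi => ?_
  have hj : Fin.castLE hmN i ∈ J := (Finset.mem_filter.1 hi).2
  set j := Fin.castLE hmN i
  have h1 := hθ j hj
  have h2 := hδ j
  refine (Lp.memLp (fourierL2 (y i))).of_le_mul
    (c := Real.sqrt (Real.exp (-2 * (S α δ α0).toReal) * θ j / δ j ^ 2))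
    ((hb.aemeasurable j hj).aestronglyMeasurable.mul (Lp.memLp _).1) ?_
  filter_upwards [hb.sum_sq_le] with ξ hξ
  rw [norm_mul]
  refine mul_le_mul_of_nonneg_right (Real.le_sqrt_of_sq_le ?_) (norm_nonneg _)
  have h3 : δ j ^ 2 * ‖b j ξ‖ ^ 2 / θ j ≤ Real.exp (-2 * (S α δ α0).toReal) :=
    (Finset.single_le_sum (f := fun j => δ j ^ 2 * ‖b j ξ‖ ^ 2 / θ j) (fun j hj => by
      have := hθ j hj
      positivity) hj).trans hξ
  rw [div_le_iff₀ h1] at h3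
  rw [le_div_iff₀ (by positivity)]
  linarith

theorem recoveryError_filterMethod_le (hmN : m ≤ N) (hδ : ∀ j, 0 < δ j)
    (hα0 : α0 ∈ convexHull ℝ (range α)) {J : Finset (Fin N)} {θ : Fin N → ℝ}
    (hθ : ∀ j ∈ J, 0 < θ j) (hθ1 : ∑ j ∈ J, θ j = 1)
    {b : Fin N → EuclideanSpace ℝ (Fin d) → ℂ} (hb : IsAdmissible α δ α0 J θ b) :
    recoveryError (weylDeriv α0) (fun i : Fin m => weylDeriv (α (Fin.castLE hmN i)))
        (weylClass m α δ) (fun i => δ (Fin.castLE hmN i)) (filterMethod hmN J b) ≤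
      ENNReal.ofReal (Real.exp (-(S α δ α0).toReal)) := by
  obtain ⟨k, hk, hnorm⟩ := exists_norm_fourierL2 d
  refine iSup₂_le fun x hx => iSup₂_le fun y hy => ?_
  rw [← ofReal_norm]
  refine ENNReal.ofReal_le_ofReal ?_
  -- With data `0` for the indices from `m` on, the accuracy of the data and the definition of the
  -- class become one condition `‖D^{α^j}x - Y_j‖ ≤ δ_j` for all `j`, and the filter may be summed
  -- over all of `J`.
  let Y : Fin N → L2 d := fun j => if h : (j : ℕ) < m then y ⟨j, h⟩ else 0
  have hY : ∀ i, Y (Fin.castLE hmN i) = y i := fun i => by simp [Y]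
  have hY0 : ∀ j : Fin N, m ≤ (j : ℕ) → Y j = 0 := fun j hj => by simp [Y, hj]
  refine le_of_mul_le_mul_left ?_ hk
  rw [← hnorm]
  refine norm_le_of_ae_eq_sum_mul J hθ hθ1 (fun j _ => hδ j) (Real.exp_pos _).le hk.le (c := b)
    (f := fun j => fourierL2 (weylDeriv (α j) x - Y j)) ?_ ?_ ?_
  · filter_upwards [hb.sum_sq_le] with ξ hξ
    rw [← Real.exp_nat_mul]
    convert hξ using 2
    push_cast
    ring
  · have hF : ∀ᵐ ξ, ∀ j, fourierL2 (weylDeriv (α j) x - Y j) ξ =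
        weylSymbol (α j) ξ * fourierL2 x ξ - fourierL2 (Y j) ξ := by
      rw [ae_all_iff]
      intro j
      rw [fourierL2_sub]
      filter_upwards [Lp.coeFn_sub (fourierL2 (weylDeriv (α j) x)) (fourierL2 (Y j)),
        fourierL2_weylDeriv (hx.1 j)] with ξ h1 h2
      rw [h1, Pi.sub_apply, h2]
    have hF0 : ∀ᵐ ξ, ∀ j : Fin N, m ≤ (j : ℕ) → fourierL2 (Y j) ξ = 0 := by
      rw [ae_all_iff]
      intro j
      by_cases hj : m ≤ (j : ℕ)
      · rw [hY0 j hj, fourierL2_zero]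
        filter_upwards [Lp.coeFn_zero ℂ 2 (volume : Measure (EuclideanSpace ℝ (Fin d)))]
          with ξ h _
        rw [h, Pi.zero_apply]
      · exact Filter.Eventually.of_forall fun ξ h => absurd h hj
    have hΦ : fourierL2 (filterMethod hmN J b y) =ᵐ[volume] filteredData hmN J b y := by
      unfold filterMethod
      rw [fourierL2_fourierInvL2]
      exact coeFn_toL2 (memLp_filteredData hmN hδ hθ hb y)
    rw [fourierL2_sub]
    filter_upwards [hF, hF0, hΦ, hb.sum_symbol,
      fourierL2_weylDeriv (hasWeylDeriv_of_mem_convexHull hα0 hx.1),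
      Lp.coeFn_sub (fourierL2 (weylDeriv α0 x)) (fourierL2 (filterMethod hmN J b y))]
      with ξ h1 h2 h3 h4 h5 h6
    rw [h6, Pi.sub_apply, h3, h5, ← h4]
    simp only [h1, mul_sub, Finset.sum_sub_distrib]
    rw [sum_eq_sum_informed hmN J (fun j => b j ξ * fourierL2 (Y j) ξ)
      fun j hj => by rw [h2 j hj, mul_zero], Finset.sum_mul]
    simp only [hY, filteredData]
    congr 1
    exact Finset.sum_congr rfl fun j _ => by ring
  · intro j _
    rw [hnorm]
    refine mul_le_mul_of_nonneg_left ?_ hk.le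
    by_cases hj : m ≤ (j : ℕ)
    · rw [hY0 j hj, sub_zero]
      exact hx.2 j hj
    · push Not at hj
      have := hy ⟨j, hj⟩
      rwa [← hY] at this

theorem filterMethod_eq_zero (hmN : m ≤ N) {J : Finset (Fin N)} (hJ : informed hmN J = ∅)
    (b : Fin N → EuclideanSpace ℝ (Fin d) → ℂ) : filterMethod hmN J b = fun _ => 0 := by
  funext y
  apply fourierL2_injective
  unfold filterMethod
  rw [fourierL2_fourierInvL2, fourierL2_zero]
  apply Lp.ext
  have h0 : filteredData hmN J b y = fun _ => 0 := by
    funext ξ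
    simp [filteredData, hJ]
  rw [h0]
  exact (coeFn_toL2 MemLp.zero').trans (Lp.coeFn_zero _ _ _).symm

/-! ### Lower bounds -/

/-- Letting `s → 1` removes the loss factor of `exists_concentrated`. -/
theorem le_of_forall_sq_mul_le {A B : ℝ} (h : ∀ s : ℝ, 0 < s → s < 1 → s ^ 2 * A ≤ B) :
    A ≤ B := by
  have ht : Filter.Tendsto (fun s : ℝ => s ^ 2 * A) (nhdsWithin 1 (Iio 1)) (nhds A) := by
    have hc : Continuous fun s : ℝ => s ^ 2 * A := by fun_prop
    simpa using (hc.tendsto 1).mono_left nhdsWithin_le_nhds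
  refine le_of_tendsto ht ?_
  filter_upwards [Ioo_mem_nhdsLT (zero_lt_one' ℝ)] with s hs
  exact h s hs.1 hs.2

theorem ofReal_le_of_forall_sq_mul_le {A : ℝ} {B : ℝ≥0∞}
    (h : ∀ s : ℝ, 0 < s → s < 1 → ENNReal.ofReal (s ^ 2 * A) ≤ B) : ENNReal.ofReal A ≤ B := by
  by_cases hB : B = ⊤
  · simp [hB]
  refine ENNReal.ofReal_le_of_le_toReal (le_of_forall_sq_mul_le fun s h0 h1 => ?_)
  exact (ENNReal.ofReal_le_iff_le_toReal hB).1 (h s h0 h1)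

theorem exp_neg_le_of_log_le {t u : ℝ} (ht : 0 < t) (h : Real.log (1 / t) ≤ u) :
    Real.exp (-u) ≤ t := by
  rw [one_div, Real.log_inv] at h
  rw [← Real.le_log_iff_exp_le ht]
  linarith

theorem le_recoveryError (hmN : m ≤ N) (hα : ∀ j i, 0 ≤ α j i) (hδ : ∀ j, 0 < δ j)
    (hα0 : α0 ∈ convexHull ℝ (range α)) (Φ : (Fin m → L2 d) → L2 d) :
    ENNReal.ofReal (Real.exp (-(S α δ α0).toReal)) ≤
      recoveryError (weylDeriv α0) (fun i : Fin m => weylDeriv (α (Fin.castLE hmN i)))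
        (weylClass m α δ) (fun i => δ (Fin.castLE hmN i)) Φ := by
  obtain ⟨η, a, hsup⟩ := exists_isSupportHyperplane (δ := δ) hα0
  rw [S_toReal hsup]
  refine ofReal_le_of_forall_sq_mul_le fun s hs0 hs1 => ?_
  obtain ⟨x, hx, hle, hge⟩ := exists_concentrated hα hα0 η a hs0 hs1
  have hxδ : ∀ j, ‖weylDeriv (α j) x‖ ≤ δ j := fun j =>
    (hle j).trans (exp_neg_le_of_log_le (hδ j) (log_le_of_S_le hsup.1 j))
  have hx' := neg_mem_weylSpace hx
  have hneg : ∀ j, weylDeriv (α j) (-x) = -weylDeriv (α j) x := fun j =>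
    weylDeriv_neg (hx j) (hx' j)
  have hneg0 : weylDeriv α0 (-x) = -weylDeriv α0 x :=
    weylDeriv_neg (hasWeylDeriv_of_mem_convexHull hα0 hx)
      (hasWeylDeriv_of_mem_convexHull hα0 hx')
  have h1 : ‖weylDeriv α0 x - Φ 0‖ₑ ≤ recoveryError (weylDeriv α0)
      (fun i : Fin m => weylDeriv (α (Fin.castLE hmN i)))
      (weylClass m α δ) (fun i => δ (Fin.castLE hmN i)) Φ :=
    le_iSup₂_of_le x ⟨hx, fun j _ => hxδ j⟩
      (le_iSup₂_of_le 0 (fun i => by simpa using hxδ _) le_rfl)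
  have h2 : ‖-weylDeriv α0 x - Φ 0‖ₑ ≤ recoveryError (weylDeriv α0)
      (fun i : Fin m => weylDeriv (α (Fin.castLE hmN i)))
      (weylClass m α δ) (fun i => δ (Fin.castLE hmN i)) Φ := by
    rw [← hneg0]
    exact le_iSup₂_of_le (-x) ⟨hx', fun j _ => by rw [hneg, norm_neg]; exact hxδ j⟩
      (le_iSup₂_of_le 0 (fun i => by simpa [hneg] using hxδ _) le_rfl)
  -- The single value `Φ 0` must serve both `x` and `-x`, so one of the two errors is at least
  -- `‖D^{α0}x‖`.
  have htri : 2 * ‖weylDeriv α0 x‖ ≤ ‖weylDeriv α0 x - Φ 0‖ + ‖-weylDeriv α0 x - Φ 0‖ := by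
    have := norm_sub_le (weylDeriv α0 x - Φ 0) (-weylDeriv α0 x - Φ 0)
    rw [sub_sub_sub_cancel_right, sub_neg_eq_add, ← two_smul ℝ, norm_smul] at this
    simpa using this
  rw [← ofReal_norm] at h1 h2
  rcases le_total ‖weylDeriv α0 x - Φ 0‖ ‖-weylDeriv α0 x - Φ 0‖ with h | h
  · exact (ENNReal.ofReal_le_ofReal (by linarith)).trans h2
  · exact (ENNReal.ofReal_le_ofReal (by linarith)).trans h1

/-! ### The multiplicative inequality -/

theorem norm_weylDeriv_le_prod (hα0 : α0 ∈ convexHull ℝ (range α)) {J : Finset (Fin N)}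
    {θ : Fin N → ℝ} (hθ : ∀ j ∈ J, 0 < θ j) (hθ1 : ∑ j ∈ J, θ j = 1)
    (hsum : ∑ j ∈ J, θ j • α j = α0) {x : L2 d} (hx : x ∈ weylSpace α) :
    ‖weylDeriv α0 x‖ ≤ ∏ j ∈ J, ‖weylDeriv (α j) x‖ ^ θ j := by
  obtain ⟨k, hk, hnorm⟩ := exists_norm_fourierL2 d
  have h := norm_le_prod_rpow J (fun j hj => (hθ j hj).le) hθ1
    (g := fourierL2 (weylDeriv α0 x)) (f := fun j => fourierL2 (weylDeriv (α j) x)) (by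
      have hF : ∀ᵐ ξ, ∀ j, fourierL2 (weylDeriv (α j) x) ξ =
          weylSymbol (α j) ξ * fourierL2 x ξ :=
        ae_all_iff.2 fun j => fourierL2_weylDeriv (hx j)
      filter_upwards [hF, ae_ne_zero d,
        fourierL2_weylDeriv (hasWeylDeriv_of_mem_convexHull hα0 hx)] with ξ h1 h2 h3
      simp only [h1, h3, norm_mul]
      rw [Finset.prod_congr rfl fun j _ => Real.mul_rpow (norm_nonneg _) (norm_nonneg _),
        Finset.prod_mul_distrib, ← norm_weylSymbol_sum J θ α ξ h2, hsum,
        ← Real.rpow_sum_of_nonneg (norm_nonneg _) fun j hj => (hθ j hj).le, hθ1, Real.rpow_one])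
  simp only [hnorm] at h
  rw [Finset.prod_congr rfl fun j _ => Real.mul_rpow hk.le (norm_nonneg _),
    Finset.prod_mul_distrib, ← Real.rpow_sum_of_nonneg hk.le fun j hj => (hθ j hj).le, hθ1,
    Real.rpow_one] at h
  exact le_of_mul_le_mul_left h hk

theorem one_le_of_norm_weylDeriv_le_mul_prod (hα : ∀ j i, 0 ≤ α j i)
    (hα0 : α0 ∈ convexHull ℝ (range α)) {J : Finset (Fin N)} {θ : Fin N → ℝ}
    (hθ : ∀ j ∈ J, 0 < θ j) {K : ℝ}
    (hK : ∀ x ∈ weylSpace α, ‖weylDeriv α0 x‖ ≤ K * ∏ j ∈ J, ‖weylDeriv (α j) x‖ ^ θ j) :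
    1 ≤ K := by
  refine le_of_forall_sq_mul_le fun s hs0 hs1 => ?_
  -- For `η = 0`, `a = 0` the frequency is `(1, …, 1)`, where every symbol has modulus `1`.
  obtain ⟨x, hx, hle, hge⟩ := exists_concentrated hα hα0 0 0 hs0 hs1
  simp only [dotProduct_zero, add_zero, neg_zero, Real.exp_zero] at hle hge
  have hP0 : 0 ≤ ∏ j ∈ J, ‖weylDeriv (α j) x‖ ^ θ j :=
    Finset.prod_nonneg fun j _ => by positivity
  have hP1 : ∏ j ∈ J, ‖weylDeriv (α j) x‖ ^ θ j ≤ 1 :=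
    Finset.prod_le_one (fun j _ => by positivity) fun j hj =>
      Real.rpow_le_one (norm_nonneg _) (hle j) (hθ j hj).le
  have h := hge.trans (hK x hx)
  have hs : 0 < s ^ 2 * 1 := by positivity
  have hKpos : 0 < K := by
    by_contra! hneg
    exact absurd (hs.trans_le h) (not_lt.2 (mul_nonpos_of_nonpos_of_nonneg hneg hP0))
  exact h.trans (mul_le_of_le_one_right hKpos.le hP1)

theorem isExactInequality_prod (hα : ∀ j i, 0 ≤ α j i)
    (hα0 : α0 ∈ convexHull ℝ (range α)) {J : Finset (Fin N)} {θ : Fin N → ℝ}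
    (hθ : ∀ j ∈ J, 0 < θ j) (hθ1 : ∑ j ∈ J, θ j = 1) (hsum : ∑ j ∈ J, θ j • α j = α0)
    (haff : AffineIndependent ℝ (fun j : J => α j)) :
    IsExactInequality (weylDeriv α0) (fun j : J => weylDeriv (α j)) (weylSpace α)
      (fun t => ∏ j : J, t j ^ θ j) := by
  refine ⟨fun x hx => ?_, ?_⟩
  · refine (norm_weylDeriv_le_prod hα0 hθ hθ1 hsum hx).trans_eq ?_
    exact (Finset.prod_coe_sort J fun j => ‖weylDeriv (α j) x‖ ^ θ j).symm
  rintro ⟨x₀, -, hlt⟩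
  -- If some norm vanished, the right-hand side would be `0` and could not be strictly larger than a
  -- supremum.
  have hpos : ∀ j : J, 0 < ‖weylDeriv (α j) x₀‖ := by
    intro j
    refine (norm_nonneg _).lt_of_ne' fun h0 => ?_
    have hz : ∏ j : J, ‖weylDeriv (α j) x₀‖ ^ θ j = 0 :=
      Finset.prod_eq_zero (Finset.mem_univ j) (by
        rw [h0, Real.zero_rpow (hθ j j.2).ne'])
    simp only [hz, ENNReal.ofReal_zero, not_lt_zero] at hlt
  -- The norms of `x₀` play the role of the `δ j`. Affine independence puts all the lifted points
  -- with `j ∈ J` on one hyperplane, at which an extremal function can be concentrated.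
  obtain ⟨η, a, hηa⟩ := exists_dotProduct_add_eq haff
    fun j : J => Real.log (1 / ‖weylDeriv (α j) x₀‖)
  have hexp : ∏ j : J, ‖weylDeriv (α j) x₀‖ ^ θ j = Real.exp (-(α0 ⬝ᵥ η + a)) := by
    rw [← sum_mul_affine J hθ1 hsum, ← Finset.sum_neg_distrib, Real.exp_sum,
      ← Finset.prod_coe_sort J]
    refine Finset.prod_congr rfl fun j _ => ?_
    rw [hηa j, one_div, Real.log_inv, mul_neg, neg_neg, mul_comm, Real.exp_mul,
      Real.exp_log (hpos j)]
  refine absurd hlt (not_lt.2 ?_)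
  simp only [hexp]
  refine ofReal_le_of_forall_sq_mul_le fun s hs0 hs1 => ?_
  obtain ⟨x, hx, hle, hge⟩ := exists_concentrated hα hα0 η a hs0 hs1
  refine le_iSup₂_of_le x hx (le_iSup_of_le (fun j => ?_) ?_)
  · exact (hle j).trans (exp_neg_le_of_log_le (hpos j) (hηa j).ge)
  · rw [← ofReal_norm]
    exact ENNReal.ofReal_le_ofReal hge


end

end OptimalRecovery

theorem corollary1 {d m N : ℕ} (hm : 1 ≤ m) (hmN : m ≤ N)
    (α : Fin N → Fin d → ℝ) (hα : ∀ j i, 0 ≤ α j i)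
    (δ : Fin N → ℝ) (hδ : ∀ j, 0 < δ j)
    (α0 : Fin d → ℝ) (hα0 : α0 ∈ convexHull ℝ (Set.range α)) :
    -- on the space in question the derivative of order `α0` is defined
    (∀ x ∈ weylSpace α, HasWeylDeriv α0 x) ∧
    -- the error of optimal recovery
    optimalError (weylDeriv α0) (fun i : Fin m => weylDeriv (α (Fin.castLE hmN i)))
        (weylClass m α δ) (fun i => δ (Fin.castLE hmN i)) =
      ENNReal.ofReal (Real.exp (-(S α δ α0).toReal)) ∧
    -- support hyperplanes and representations as considered below exist
    (∃ η a, IsSupportHyperplane α δ α0 η a) ∧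
    (∀ η a, IsSupportHyperplane α δ α0 η a → ∃ J θ, IsRepresentation α δ α0 η a J θ ∧
      AffineIndependent ℝ (fun j : J => α j)) ∧
    ∀ (η : Fin d → ℝ) (a : ℝ) (J : Finset (Fin N)) (θ : Fin N → ℝ),
      IsSupportHyperplane α δ α0 η a → IsRepresentation α δ α0 η a J θ →
      -- optimal methods
      ((informed hmN J).Nonempty →
        (∃ b, IsAdmissible α δ α0 J θ b) ∧
        ∀ b, IsAdmissible α δ α0 J θ b →
          (∀ y : Fin m → L2 d, MemLp (filteredData hmN J b y) 2 volume) ∧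
          IsOptimalMethod (weylDeriv α0) (fun i : Fin m => weylDeriv (α (Fin.castLE hmN i)))
            (weylClass m α δ) (fun i => δ (Fin.castLE hmN i)) (filterMethod hmN J b)) ∧
      (informed hmN J = ∅ →
        IsOptimalMethod (weylDeriv α0) (fun i : Fin m => weylDeriv (α (Fin.castLE hmN i)))
          (weylClass m α δ) (fun i => δ (Fin.castLE hmN i)) (fun _ => 0)) ∧
      -- the inequality, the optimality of its constant `1`, and its exactness
      (∀ x ∈ weylSpace α, ‖weylDeriv α0 x‖ ≤ ∏ j ∈ J, ‖weylDeriv (α j) x‖ ^ θ j) ∧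
      (∀ K : ℝ, (∀ x ∈ weylSpace α, ‖weylDeriv α0 x‖ ≤ K * ∏ j ∈ J, ‖weylDeriv (α j) x‖ ^ θ j) →
        1 ≤ K) ∧
      (AffineIndependent ℝ (fun j : J => α j) →
        IsExactInequality (weylDeriv α0) (fun j : J => weylDeriv (α j)) (weylSpace α)
          (fun t => ∏ j : J, t j ^ θ j)) := by
  have hopt : ∀ {J : Finset (Fin N)} {θ : Fin N → ℝ} {b}, (∀ j ∈ J, 0 < θ j) →
      ∑ j ∈ J, θ j = 1 → IsAdmissible α δ α0 J θ b →
      recoveryError (weylDeriv α0) (fun i : Fin m => weylDeriv (α (Fin.castLE hmN i)))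
        (weylClass m α δ) (fun i => δ (Fin.castLE hmN i)) (filterMethod hmN J b) ≤
      ENNReal.ofReal (Real.exp (-(S α δ α0).toReal)) := fun hθ hθ1 hb =>
    recoveryError_filterMethod_le hmN hδ hα0 hθ hθ1 hb
  have hE : optimalError (weylDeriv α0) (fun i : Fin m => weylDeriv (α (Fin.castLE hmN i)))
      (weylClass m α δ) (fun i => δ (Fin.castLE hmN i)) =
      ENNReal.ofReal (Real.exp (-(S α δ α0).toReal)) := by
    refine le_antisymm ?_ (le_iInf fun Φ => le_recoveryError hmN hα hδ hα0 Φ)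
    obtain ⟨η, a, hsup⟩ := exists_isSupportHyperplane (δ := δ) hα0
    obtain ⟨J, θ, hrep, -⟩ := exists_isRepresentation hα0 hsup
    obtain ⟨b, hb⟩ := exists_isAdmissible hδ hsup hrep
    exact (iInf_le _ (filterMethod hmN J b)).trans (hopt hrep.pos hrep.sum_eq_one hb)
  refine ⟨fun x hx => hasWeylDeriv_of_mem_convexHull hα0 hx, hE,
    exists_isSupportHyperplane hα0, fun η a h => exists_isRepresentation hα0 h,
    fun η a J θ hsup hrep => ?_⟩
  have hmethod : ∀ b, IsAdmissible α δ α0 J θ b →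
      IsOptimalMethod (weylDeriv α0) (fun i : Fin m => weylDeriv (α (Fin.castLE hmN i)))
        (weylClass m α δ) (fun i => δ (Fin.castLE hmN i)) (filterMethod hmN J b) := fun b hb =>
    le_antisymm (hE ▸ hopt hrep.pos hrep.sum_eq_one hb) (iInf_le _ _)
  refine ⟨fun _ => ⟨exists_isAdmissible hδ hsup hrep, fun b hb =>
    ⟨memLp_filteredData hmN hδ hrep.pos hb, hmethod b hb⟩⟩, fun hM => ?_,
    fun x hx => norm_weylDeriv_le_prod hα0 hrep.pos hrep.sum_eq_one hrep.sum_smul_eq hx,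
    fun K hK => one_le_of_norm_weylDeriv_le_mul_prod hα hα0 hrep.pos hK,
    fun haff => isExactInequality_prod hα hα0 hrep.pos hrep.sum_eq_one hrep.sum_smul_eq haff⟩
  -- With `M` empty the filter reads no data, so the zero method is itself an optimal filter.
  obtain ⟨b, hb⟩ := exists_isAdmissible hδ hsup hrep
  rw [← filterMethod_eq_zero hmN hM b]
  exact hmethod b hb
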